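/- Let $\lambda>0$. Let $\mathcal E$ be a Poisson point process on $\mathbb R$ with intensity $\lambda$ times Lebesgue measure and, given $\mathcal E$, let $\{(B^x_s)_{s\ge 0} : x\in\mathcal E\}$ be independent one-dimensional Brownian motions with $B^x_0=x$, whose displacements $(B^x_s-x)_{s\ge0}$ are independent of $\mathcal E$. Concretely, let $(W_{n,z})_{(n,z)\in\mathbb N\times\mathbb Z}$ be independent standard Brownian motions started at $0$, independent of $\mathcal E$, and set $B^x_s = x + W_{n_0(x),\,z(n_0(x),x)}(s)$, where $z(n,x)$ is the integer $z$ with $x\in(z2^{-n},(z+1)2^{-n}]$ and $n_0(x)$ is the least $n\ge 1$ such that the interval $(z(n,x)2^{-n},(z(n,x)+1)2^{-n}]$ contains no point of $\mathcal E$ other than $x$. For $t\ge 0$ let $$\mathcal O_t=\bigcup_{x\in\mathcal E}\{B^x_s : 0\le s\le t\}.$$ A component of $\mathcal O_t$ is a subset of $\mathcal O_t$ any two points of which are joined by a continuous path in $\mathcal O_t$; a cluster of $\mathcal O_t$ is a component that is maximal with respect to inclusion. Then, for every $t\ge 0$, almost surely $\mathcal O_t$ has no unbounded cluster. -/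

import Mathlib

open MeasureTheory ProbabilityTheory
open scoped NNReal ENNReal

noncomputable section

namespace BrownianPercolation

variable {Ω : Type*} [MeasurableSpace Ω]

/-! ### Poisson point processes -/

/-- The number (possibly infinite) of points of the random set `E` that lie in `A`. -/
def pointCount {X : Type*} (E : Ω → Set X) (A : Set X) (ω : Ω) : ℕ∞ :=
  (E ω ∩ A).encard

/-- The random set `E` is a (simple) Poisson point process with intensity measure `μ`: the numbers
of points in measurable sets are random variables, the number of points in a set of finite
intensity is Poisson distributed with parameter the intensity of that set, and the numbers of
points in disjoint sets are independent. -/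
structure IsPoissonPointProcess {X : Type*} [MeasurableSpace X]
    (E : Ω → Set X) (μ : Measure X) (P : Measure Ω) : Prop where
  measurable_pointCount : ∀ A : Set X, MeasurableSet A → Measurable (pointCount E A)
  hasLaw_pointCount : ∀ A : Set X, MeasurableSet A → μ A < ∞ →
    HasLaw (pointCount E A) ((poissonMeasure (μ A).toNNReal).map (Nat.cast : ℕ → ℕ∞)) P
  iIndepFun_pointCount : ∀ (n : ℕ) (A : Fin n → Set X), (∀ i, MeasurableSet (A i)) →
    (Pairwise fun i j ↦ Disjoint (A i) (A j)) → iIndepFun (fun i ↦ pointCount E (A i)) P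

/-! ### Attaching Brownian paths to the points of a point process on the line -/

/-- The binary interval `(z 2⁻ⁿ, (z + 1) 2⁻ⁿ]`. -/
def cube (n : ℕ) (z : ℤ) : Set ℝ := Set.Ioc ((z : ℝ) / 2 ^ n) (((z : ℝ) + 1) / 2 ^ n)

/-- The index `z` of the binary interval of level `n` that contains `x`
(see `mem_cube_iff`). -/
def cubeIndex (n : ℕ) (x : ℝ) : ℤ := ⌈x * 2 ^ n⌉ - 1

theorem mem_cube_iff (n : ℕ) (z : ℤ) (x : ℝ) : x ∈ cube n z ↔ z = cubeIndex n x := by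
  have h : (0 : ℝ) < 2 ^ n := by positivity
  rw [cube, Set.mem_Ioc, div_lt_iff₀ h, le_div_iff₀ h, cubeIndex, eq_sub_iff_add_eq, eq_comm,
    Int.ceil_eq_iff]
  push_cast
  rw [add_sub_cancel_right]

/-- The first level `n ≥ 1` at which the binary interval around `x` contains no point of the
configuration `S` other than `x`. -/
def isolationLevel (S : Set ℝ) (x : ℝ) : ℕ :=
  sInf {n : ℕ | 1 ≤ n ∧ cube n (cubeIndex n x) ∩ S = {x}}

/-- The label of the point `x` of the configuration `S`: the level and the index of the first
binary interval that isolates `x` in `S`. Distinct points of a locally finite configuration have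
distinct labels. -/
def label (S : Set ℝ) (x : ℝ) : ℕ × ℤ :=
  (isolationLevel S x, cubeIndex (isolationLevel S x) x)

/-- The model: `E` is a Poisson point process on the line with intensity `lam` times Lebesgue
measure, and `W` is a family, indexed by the labels, of independent standard Brownian motions
(started at `0`), which is independent of `E`. -/
structure IsModel (lam : ℝ≥0) (E : Ω → Set ℝ) (W : ℕ × ℤ → ℝ≥0 → Ω → ℝ) (P : Measure Ω) :
    Prop where
  isPoissonPointProcess : IsPoissonPointProcess E (lam • (volume : Measure ℝ)) P
  measurable : ∀ i s, Measurable (W i s)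
  isBrownianReal : ∀ i, IsBrownianReal (W i) P
  iIndepFun : iIndepFun (fun i (ω : Ω) (s : ℝ≥0) ↦ W i s ω) P
  indepFun : IndepFun
    (fun (ω : Ω) (A : {A : Set ℝ // MeasurableSet A}) ↦ pointCount E A.1 ω)
    (fun (ω : Ω) (i : ℕ × ℤ) (s : ℝ≥0) ↦ W i s ω) P

/-- The Brownian path `s ↦ B_s^x` attached to the point `x` of the configuration `E ω`; it starts
at `x`, and its displacement is the Brownian motion that carries the label of `x`. -/
def path (E : Ω → Set ℝ) (W : ℕ × ℤ → ℝ≥0 → Ω → ℝ) (ω : Ω) (x : ℝ) (s : ℝ≥0) : ℝ :=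
  x + W (label (E ω) x) s ω

/-- The occupied set at time `t`: the union over the points `x` of the point process of the
Brownian paths `{B_s^x : 0 ≤ s ≤ t}`. -/
def occupiedSet (E : Ω → Set ℝ) (W : ℕ × ℤ → ℝ≥0 → Ω → ℝ) (t : ℝ≥0) (ω : Ω) : Set ℝ :=
  ⋃ x ∈ E ω, ⋃ s ∈ Set.Icc 0 t, {path E W ω x s}

/-! ### Clusters -/

/-- A component of `O` is a subset of `O` any two points of which are joined by a continuous
path in `O`. -/
def IsComponent {X : Type*} [TopologicalSpace X] (O C : Set X) : Prop :=
  C ⊆ O ∧ ∀ x ∈ C, ∀ y ∈ C, JoinedIn O x y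

/-- A cluster of `O` is a component of `O` that is maximal with respect to inclusion. -/
def IsCluster {X : Type*} [TopologicalSpace X] (O C : Set X) : Prop :=
  Maximal (IsComponent O) C

end BrownianPercolation

end

/-! On the line, a path between two points covers the interval between them, so an unbounded
component of the occupied set contains a half-line (`IsComponent.ordConnected_subset`). It therefore
suffices that each integer half-line almost surely contains an uncovered integer.

Take about `exp (3λb)` integers at mutual distance at least `2b`. If all are covered, either every
window of radius `b` around them holds a Poisson point, which has probability at most `exp (-exp
(λb))` by independence, or some path from outside its window reaches a centre. The Gaussian tail
beats every exponential rate, so the latter costs `C * exp (-4λb)` per centre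
(`IsModel.exists_measure_farEvent_le`), hence `2C * exp (-λb)` in total. Let `b → ∞`.

To bound the far event, sum over deterministic labels instead of random points: whether a label is
used depends only on `E`, hence is independent of its Brownian motion, and the expected number of
used labels per unit interval is finite. -/

namespace BrownianPercolation

/-! ### Maximal tail bounds for Brownian motion -/

section BrownianTail

variable {Ω : Type*} [MeasurableSpace Ω] {P : Measure Ω} {B : ℝ≥0 → Ω → ℝ}

/-- Increments are symmetric, so the two orderings are equally likely, and together they exhaust the
space. -/
theorem one_le_two_mul_measure_increment_nonneg (hB : IsPreBrownianReal B P) (s t : ℝ≥0) :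
    1 ≤ 2 * P {ω | B s ω ≤ B t ω} := by
  have : IsProbabilityMeasure P := hB.isGaussianProcess.isProbabilityMeasure
  have h1 := hB.hasLaw_sub t s
  have h2 := hB.hasLaw_sub s t
  rw [nndist_comm] at h2
  have e1 : P {ω | B s ω ≤ B t ω} = gaussianReal 0 (nndist t.1 s.1) (Set.Ici 0) := by
    rw [← h1.map_eq, Measure.map_apply_of_aemeasurable h1.aemeasurable measurableSet_Ici]
    congr 1
    ext ω
    simp
  have e2 : P {ω | B t ω ≤ B s ω} = gaussianReal 0 (nndist t.1 s.1) (Set.Ici 0) := by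
    rw [← h2.map_eq, Measure.map_apply_of_aemeasurable h2.aemeasurable measurableSet_Ici]
    congr 1
    ext ω
    simp
  calc (1 : ℝ≥0∞) = P Set.univ := measure_univ.symm
    _ ≤ P ({ω | B s ω ≤ B t ω} ∪ {ω | B t ω ≤ B s ω}) :=
        measure_mono fun ω _ ↦ le_total (B s ω) (B t ω)
    _ ≤ _ := (measure_union_le _ _).trans_eq (by rw [e1, e2, two_mul])

/-- **Lévy's maximal inequality** for Brownian motion along a finite set of times. -/
theorem measure_exists_lt_le (hB : IsPreBrownianReal B P) (hm : ∀ s, Measurable (B s))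
    {τ : ℕ → ℝ≥0} (hτ : Monotone τ) {N : ℕ} {t : ℝ≥0} (hN : τ N ≤ t) (r : ℝ) :
    P {ω | ∃ k ≤ N, r < B (τ k) ω} ≤ 2 * P {ω | r < B t ω} := by
  have : IsProbabilityMeasure P := hB.isGaussianProcess.isProbabilityMeasure
  set A : ℕ → Set Ω := fun k ↦ {ω | r < B (τ k) ω ∧ ∀ j < k, B (τ j) ω ≤ r}
  have hA : ∀ k, MeasurableSet (A k) := fun k ↦ by measurability
  -- `A k` is first passage at index `k`. It depends on the past of `τ k`, so it is independent of
  -- the later increment, which is nonnegative with probability at least one half.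
  have hstep : ∀ k ≤ N, P (A k) ≤ 2 * P (A k ∩ {ω | B (τ k) ω ≤ B t ω}) := by
    intro k hk
    have hkt : τ k ≤ t := (hτ hk).trans hN
    have hind := (hB.indepFun_shift (τ k)).measure_inter_preimage_eq_mul
      {f | 0 ≤ f (t - τ k)}
      {g : Set.Iic (τ k) → ℝ | r < g ⟨τ k, Set.self_mem_Iic⟩ ∧ ∀ j, ∀ h : j < k, g ⟨τ j, hτ h.le⟩ ≤ r}
      (measurableSet_le measurable_const (measurable_pi_apply _))
      (by
        simp only [Set.ofPred_and, Set.ofPred_forall]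
        refine (measurableSet_lt measurable_const (measurable_pi_apply _)).inter ?_
        exact .iInter fun j ↦ .iInter fun h ↦
          measurableSet_le (measurable_pi_apply _) measurable_const)
    have e1 : (fun ω s ↦ B (τ k + s) ω - B (τ k) ω) ⁻¹' {f | 0 ≤ f (t - τ k)} =
        {ω | B (τ k) ω ≤ B t ω} := by
      ext ω
      simp [add_tsub_cancel_of_le hkt]
    have e2 : (fun ω (s : Set.Iic (τ k)) ↦ B s ω) ⁻¹' {g : Set.Iic (τ k) → ℝ |
        r < g ⟨τ k, Set.self_mem_Iic⟩ ∧ ∀ j, ∀ h : j < k, g ⟨τ j, hτ h.le⟩ ≤ r} = A k := rfl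
    rw [e1, e2] at hind
    rw [Set.inter_comm, hind, ← mul_assoc]
    exact le_mul_of_one_le_left' (one_le_two_mul_measure_increment_nonneg hB _ _)
  have hsub : {ω | ∃ k ≤ N, r < B (τ k) ω} ⊆ ⋃ k ∈ Finset.range (N + 1), A k := by
    rintro ω ⟨k, hk, hω⟩
    classical
    have hex : ∃ k, r < B (τ k) ω := ⟨k, hω⟩
    refine Set.mem_iUnion₂.2 ⟨Nat.find hex, ?_, Nat.find_spec hex,
      fun j hj ↦ not_lt.1 (Nat.find_min hex hj)⟩
    exact Finset.mem_range.2 (Nat.lt_succ_of_le ((Nat.find_min' hex hω).trans hk))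
  have hdisj : Set.PairwiseDisjoint (Finset.range (N + 1) : Set ℕ)
      fun k ↦ A k ∩ {ω | B (τ k) ω ≤ B t ω} := by
    intro i _ j _ hij
    refine Set.disjoint_left.2 fun ω hi hj ↦ ?_
    rcases lt_or_gt_of_ne hij with h | h
    · exact (hi.1.1.trans_le (hj.1.2 i h)).false
    · exact (hj.1.1.trans_le (hi.1.2 j h)).false
  calc P {ω | ∃ k ≤ N, r < B (τ k) ω} ≤ P (⋃ k ∈ Finset.range (N + 1), A k) := measure_mono hsub
    _ ≤ ∑ k ∈ Finset.range (N + 1), P (A k) := measure_biUnion_finset_le _ _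
    _ ≤ ∑ k ∈ Finset.range (N + 1), 2 * P (A k ∩ {ω | B (τ k) ω ≤ B t ω}) :=
        Finset.sum_le_sum fun k hk ↦ hstep k (Nat.lt_succ_iff.1 (Finset.mem_range.1 hk))
    _ = 2 * P (⋃ k ∈ Finset.range (N + 1), A k ∩ {ω | B (τ k) ω ≤ B t ω}) := by
        rw [measure_biUnion_finset hdisj fun k _ ↦ (hA k).inter (measurableSet_le (hm _) (hm _)),
          Finset.mul_sum]
    _ ≤ 2 * P {ω | r < B t ω} := by
        gcongr
        exact Set.iUnion₂_subset fun k _ ω hω ↦ hω.1.1.trans_le hω.2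

theorem measure_lt_le_exp (hB : IsPreBrownianReal B P) (t : ℝ≥0) {a : ℝ} (ha : 0 ≤ a) (r : ℝ) :
    P {ω | r < B t ω} ≤ ENNReal.ofReal (Real.exp (a ^ 2 * t / 2 - a * r)) := by
  have : IsProbabilityMeasure P := hB.isGaussianProcess.isProbabilityMeasure
  have hlaw := hB.hasLaw_eval t
  have hint : Integrable (fun ω ↦ Real.exp (a * B t ω)) P := by
    have h := integrable_exp_mul_gaussianReal (μ := 0) (v := t) a
    rw [← hlaw.map_eq] at h
    exact h.comp_aemeasurable hlaw.aemeasurable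
  have hch := measure_ge_le_exp_mul_mgf r ha hint
  rw [mgf_gaussianReal hlaw.map_eq, ← Real.exp_add] at hch
  calc P {ω | r < B t ω} ≤ P {ω | r ≤ B t ω} := measure_mono fun ω (hω : r < B t ω) ↦ hω.le
    _ = ENNReal.ofReal (P.real {ω | r ≤ B t ω}) := by simp [measureReal_def]
    _ ≤ _ := ENNReal.ofReal_le_ofReal (hch.trans_eq (by congr 1; ring))

/-- The paths whose absolute value exceeds `r` at some dyadic fraction of the time `t`. -/
def exceeds (t : ℝ≥0) (r : ℝ) : Set (ℝ≥0 → ℝ) :=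
  {f | ∃ n k : ℕ, k ≤ 2 ^ n ∧ r < |f (k / 2 ^ n * t)|}

theorem measurableSet_exceeds (t : ℝ≥0) (r : ℝ) : MeasurableSet (exceeds t r) := by
  simp only [exceeds, Set.ofPred_exists, Set.ofPred_and]
  exact .iUnion fun n ↦ .iUnion fun k ↦ (MeasurableSet.const _).inter
    (measurableSet_lt measurable_const (measurable_pi_apply _).abs)

/-- Dyadic fractions approximate `s / t`, and a strict inequality persists nearby by continuity. -/
theorem mem_exceeds_of_continuous {f : ℝ≥0 → ℝ} (hf : Continuous f) {s t : ℝ≥0} (hst : s ≤ t)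
    {r : ℝ} (hr : r < |f s|) : f ∈ exceeds t r := by
  obtain ⟨u, hu, rfl⟩ : ∃ u : ℝ≥0, u ≤ 1 ∧ s = u * t := by
    rcases eq_or_ne t 0 with rfl | ht
    · exact ⟨1, le_rfl, by simpa using hst⟩
    · exact ⟨s / t, div_le_one_of_le₀ hst zero_le, (div_mul_cancel₀ s ht).symm⟩
  have h2 : Filter.Tendsto (fun n : ℕ ↦ (2 : ℝ) ^ n) Filter.atTop Filter.atTop :=
    tendsto_pow_atTop_atTop_of_one_lt one_lt_two
  have hlim : Filter.Tendsto (fun n : ℕ ↦ (⌊(u : ℝ) * 2 ^ n⌋₊ / 2 ^ n : ℝ≥0)) Filter.atTop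
      (nhds u) := by
    rw [← NNReal.tendsto_coe]
    push_cast
    exact (tendsto_nat_floor_mul_div_atTop u.2).comp h2
  have hev := ((hf.abs.tendsto (u * t)).comp (hlim.mul_const t)).eventually_const_lt hr
  obtain ⟨n, hn⟩ := hev.exists
  refine ⟨n, ⌊(u : ℝ) * 2 ^ n⌋₊, Nat.floor_le_of_le ?_, hn⟩
  push_cast
  exact mul_le_of_le_one_left (by positivity) hu

/-- The dyadic grids are nested, so the uniform bound on finite grids passes to their increasing
union. -/
theorem measure_exists_dyadic_lt_le (hB : IsPreBrownianReal B P) (hm : ∀ s, Measurable (B s))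
    (t : ℝ≥0) (r : ℝ) :
    P {ω | ∃ n k : ℕ, k ≤ 2 ^ n ∧ r < B (k / 2 ^ n * t) ω} ≤ 2 * P {ω | r < B t ω} := by
  have hmono : Monotone fun n : ℕ ↦ {ω | ∃ k : ℕ, k ≤ 2 ^ n ∧ r < B (k / 2 ^ n * t) ω} := by
    refine monotone_nat_of_le_succ fun n ω ↦ ?_
    rintro ⟨k, hk, h⟩
    refine ⟨2 * k, by rw [pow_succ]; lia, ?_⟩
    convert h using 3
    push_cast
    rw [pow_succ']
    field_simp
  have hU : {ω | ∃ n k : ℕ, k ≤ 2 ^ n ∧ r < B (k / 2 ^ n * t) ω} =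
      ⋃ n : ℕ, {ω | ∃ k : ℕ, k ≤ 2 ^ n ∧ r < B (k / 2 ^ n * t) ω} := by
    ext ω
    simp
  rw [hU, hmono.measure_iUnion]
  refine iSup_le fun n ↦ measure_exists_lt_le hB hm (τ := fun k ↦ k / 2 ^ n * t) ?_ ?_ r
  · intro i j hij
    dsimp only
    gcongr
  · simp

theorem measure_exceeds_le (hB : IsPreBrownianReal B P) (hm : ∀ s, Measurable (B s))
    (t : ℝ≥0) {a : ℝ} (ha : 0 ≤ a) (r : ℝ) :
    P {ω | (fun s ↦ B s ω) ∈ exceeds t r} ≤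
      4 * ENNReal.ofReal (Real.exp (a ^ 2 * t / 2 - a * r)) := by
  have h1 := (measure_exists_dyadic_lt_le hB hm t r).trans
    (mul_le_mul_right (measure_lt_le_exp hB t ha r) 2)
  have h2 := (measure_exists_dyadic_lt_le hB.neg (fun s ↦ (hm s).neg) t r).trans
    (mul_le_mul_right (measure_lt_le_exp hB.neg t ha r) 2)
  calc _ ≤ P ({ω | ∃ n k : ℕ, k ≤ 2 ^ n ∧ r < B (k / 2 ^ n * t) ω} ∪
        {ω | ∃ n k : ℕ, k ≤ 2 ^ n ∧ r < (-B) (k / 2 ^ n * t) ω}) := by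
        refine measure_mono ?_
        rintro ω ⟨n, k, hk, h⟩
        rcases lt_abs.1 h with h | h
        · exact Or.inl ⟨n, k, hk, h⟩
        · exact Or.inr ⟨n, k, hk, h⟩
    _ ≤ _ := (measure_union_le _ _).trans (add_le_add h1 h2)
    _ = _ := by ring

end BrownianTail

end BrownianPercolation

namespace BrownianPercolation

/-! ### Used labels as functions of counts in binary intervals -/

section Labels

theorem mem_cube_cubeIndex (n : ℕ) (x : ℝ) : x ∈ cube n (cubeIndex n x) :=
  (mem_cube_iff n _ x).2 rfl

/-- The right endpoint of the binary interval with label `i`. -/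
noncomputable def rightEnd (i : ℕ × ℤ) : ℝ := ((i.2 : ℝ) + 1) / 2 ^ i.1

/-- Binary intervals are nested and contain their right endpoint, which thus serves as a
deterministic representative of the points with label `i`. -/
theorem cubeIndex_eq_of_mem_cube {i : ℕ × ℤ} {x : ℝ} (hx : x ∈ cube i.1 i.2) {l : ℕ}
    (hl : l ≤ i.1) : cubeIndex l x = cubeIndex l (rightEnd i) := by
  obtain ⟨k, z⟩ := i
  obtain ⟨d, rfl⟩ := Nat.exists_eq_add_of_le hl
  have hz : ⌈x * 2 ^ (l + d)⌉ = z + 1 := by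
    have := (mem_cube_iff _ _ x).1 hx
    simp only [cubeIndex] at this
    lia
  simp only [cubeIndex, rightEnd]
  congr 1
  refine eq_of_forall_ge_iff fun m ↦ ?_
  have h1 : x * 2 ^ l ≤ m ↔ x * 2 ^ (l + d) ≤ ((m * 2 ^ d : ℤ) : ℝ) := by
    push_cast
    rw [pow_add, ← mul_assoc, mul_le_mul_iff_left₀ (by positivity)]
  have h2 : ((z : ℝ) + 1) / 2 ^ (l + d) * 2 ^ l ≤ m ↔ ((z + 1 : ℤ) : ℝ) ≤ ((m * 2 ^ d : ℤ) : ℝ) := by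
    push_cast
    rw [pow_add, div_mul_eq_mul_div, div_le_iff₀ (by positivity), mul_comm ((2 : ℝ) ^ l),
      ← mul_assoc, mul_le_mul_iff_left₀ (by positivity)]
  rw [Int.ceil_le, Int.ceil_le, h1, h2, Int.cast_le, ← hz, Int.ceil_le]

/-- The binary interval with label `i` contains exactly one point of `S`, and no coarser binary
interval around it does. -/
def IsUsed (S : Set ℝ) (i : ℕ × ℤ) : Prop :=
  1 ≤ i.1 ∧ (S ∩ cube i.1 i.2).encard = 1 ∧
    ∀ l, 1 ≤ l → l < i.1 → (S ∩ cube l (cubeIndex l (rightEnd i))).encard ≠ 1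

theorem IsUsed.exists_label_eq {S : Set ℝ} {i : ℕ × ℤ} (hi : IsUsed S i) :
    ∃ x ∈ S, x ∈ cube i.1 i.2 ∧ label S x = i := by
  obtain ⟨h1, h2, h3⟩ := hi
  obtain ⟨x, hx⟩ := Set.encard_eq_one.1 h2
  have hxm : x ∈ S ∩ cube i.1 i.2 := hx ▸ rfl
  refine ⟨x, hxm.1, hxm.2, ?_⟩
  have hz : i.2 = cubeIndex i.1 x := (mem_cube_iff _ _ _).1 hxm.2
  have hlev : isolationLevel S x = i.1 := by
    refine le_antisymm (Nat.sInf_le ⟨h1, by rw [← hz, Set.inter_comm, hx]⟩) ?_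
    refine le_csInf ⟨i.1, h1, by rw [← hz, Set.inter_comm, hx]⟩ ?_
    rintro l ⟨hl1, hl2⟩
    by_contra! hlt
    refine h3 l hl1 hlt ?_
    rw [← cubeIndex_eq_of_mem_cube hxm.2 hlt.le, Set.inter_comm, hl2, Set.encard_singleton]
  rw [label, hlev, ← hz]

theorem abs_sub_le_of_mem_cube {n : ℕ} {z : ℤ} {x y : ℝ} (hx : x ∈ cube n z) (hy : y ∈ cube n z) :
    |y - x| ≤ (1 / 2) ^ n := by
  have h : ((z : ℝ) + 1) / 2 ^ n = z / 2 ^ n + (1 / 2) ^ n := by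
    rw [add_div, one_div_pow]
  rw [cube, Set.mem_Ioc, h] at hx hy
  rw [abs_le]
  constructor <;> linarith [hx.1, hx.2, hy.1, hy.2]

/-- The finitely many other points of the unit interval around `x` keep a positive distance from it.
-/
theorem exists_cube_inter_eq_singleton {S : Set ℝ} (hS : ∀ j : ℤ, (S ∩ cube 0 j).Finite) {x : ℝ}
    (hx : x ∈ S) : ∃ n, 1 ≤ n ∧ cube n (cubeIndex n x) ∩ S = {x} := by
  have hF : ((S ∩ cube 0 (cubeIndex 0 x)) \ {x}).Finite := (hS _).sdiff
  obtain ⟨δ, hδ, hball⟩ := Metric.isOpen_iff.1 hF.isClosed.isOpen_compl x (by simp)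
  obtain ⟨n, hn⟩ := exists_pow_lt_of_lt_one hδ (by norm_num : (1 / 2 : ℝ) < 1)
  refine ⟨n + 1, by lia, Set.Subset.antisymm ?_
    (Set.singleton_subset_iff.2 ⟨mem_cube_cubeIndex _ _, hx⟩)⟩
  rintro y ⟨hy, hyS⟩
  by_contra hne
  have hd : dist y x < δ := by
    rw [Real.dist_eq]
    refine (abs_sub_le_of_mem_cube (mem_cube_cubeIndex _ _) hy).trans_lt (lt_of_le_of_lt ?_ hn)
    exact pow_le_pow_of_le_one (by norm_num) (by norm_num) (by lia)
  refine hball hd ⟨⟨hyS, ?_⟩, hne⟩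
  rw [mem_cube_iff, cubeIndex_eq_of_mem_cube (i := (n + 1, cubeIndex (n + 1) x))
    (mem_cube_cubeIndex _ _) (Nat.zero_le _), cubeIndex_eq_of_mem_cube
    (i := (n + 1, cubeIndex (n + 1) x)) hy (Nat.zero_le _)]

/-- Local finiteness makes the infimum in `isolationLevel` attained, not the default `0`. -/
theorem isUsed_label {S : Set ℝ} (hS : ∀ j : ℤ, (S ∩ cube 0 j).Finite) {x : ℝ} (hx : x ∈ S) :
    IsUsed S (label S x) := by
  have hne := exists_cube_inter_eq_singleton hS hx
  obtain ⟨h1, h2⟩ : isolationLevel S x ∈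
      {n : ℕ | 1 ≤ n ∧ cube n (cubeIndex n x) ∩ S = {x}} := Nat.sInf_mem hne
  refine ⟨h1, ?_, fun l hl1 hl2 hl3 ↦ ?_⟩
  · rw [label, Set.inter_comm, h2, Set.encard_singleton]
  · rw [← cubeIndex_eq_of_mem_cube (i := label S x) (mem_cube_cubeIndex _ x) hl2.le] at hl3
    obtain ⟨y, hy⟩ := Set.encard_eq_one.1 hl3
    have hxy : x ∈ S ∩ cube l (cubeIndex l x) := ⟨hx, mem_cube_cubeIndex _ _⟩
    have : x = y := by rw [hy] at hxy; exact hxy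
    refine Nat.notMem_of_lt_sInf hl2 ⟨hl1, ?_⟩
    rw [Set.inter_comm, hy, this]

/-- The labels of the binary intervals that are contained in `(j, j + 1]`. -/
def labelBlock (j : ℤ) : Set (ℕ × ℤ) := {i | cubeIndex 0 (rightEnd i) = j}

theorem label_mem_labelBlock (S : Set ℝ) (x : ℝ) : label S x ∈ labelBlock (cubeIndex 0 x) :=
  (cubeIndex_eq_of_mem_cube (i := label S x) (mem_cube_cubeIndex _ x) (Nat.zero_le _)).symm

/-- `label S` maps the points of the unit interval onto a set containing these labels. -/
theorem encard_isUsed_le (S : Set ℝ) (j : ℤ) :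
    {i | i ∈ labelBlock j ∧ IsUsed S i}.encard ≤ (S ∩ cube 0 j).encard := by
  refine (Set.encard_le_encard ?_).trans (Set.encard_image_le (label S) _)
  rintro i ⟨hij, hi⟩
  obtain ⟨x, hxS, hxi, hlab⟩ := hi.exists_label_eq
  exact ⟨x, ⟨hxS, (mem_cube_iff _ _ _).2
    (hij.symm.trans (cubeIndex_eq_of_mem_cube hxi (Nat.zero_le _)).symm)⟩, hlab⟩

end Labels

/-! ### Mean and void probability of Poisson counts -/

section Poisson

/-- The mean of the Poisson distribution, as a lower Lebesgue integral. -/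
noncomputable def poissonMean (r : ℝ≥0) : ℝ≥0∞ := ∫⁻ n : ℕ, (n : ℝ≥0∞) ∂poissonMeasure r

theorem poissonMean_ne_top (r : ℝ≥0) : poissonMean r ≠ ∞ := by
  have hint : Integrable (fun n : ℕ ↦ (n : ℝ)) (poissonMeasure r) := by
    rw [integrable_poissonMeasure_iff]
    refine .of_nonneg_of_le (fun n ↦ by positivity) (fun n ↦ ?_)
      ((Real.summable_pow_div_factorial (2 * r)).mul_left (Real.exp (-r)))
    have hn : (n : ℝ) ≤ 2 ^ n := by exact_mod_cast Nat.lt_two_pow_self.le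
    rw [Real.norm_natCast, mul_pow, ← mul_div_assoc, div_mul_eq_mul_div]
    gcongr ?_ / _
    calc Real.exp (-r) * r ^ n * n ≤ Real.exp (-r) * r ^ n * 2 ^ n := by gcongr
      _ = _ := by ring
  have h := hint.lintegral_lt_top
  simpa [poissonMean] using h.ne

variable {Ω X : Type*} [MeasurableSpace Ω] [MeasurableSpace X] {E : Ω → Set X} {μ : Measure X}
  {P : Measure Ω}

theorem IsPoissonPointProcess.lintegral_pointCount (hE : IsPoissonPointProcess E μ P)
    {A : Set X} (hA : MeasurableSet A) (hμ : μ A < ∞) :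
    ∫⁻ ω, (pointCount E A ω : ℝ≥0∞) ∂P = poissonMean (μ A).toNNReal := by
  rw [(hE.hasLaw_pointCount A hA hμ).lintegral_comp (f := fun n ↦ (n : ℝ≥0∞))
    (Measurable.of_discrete.aemeasurable), lintegral_map .of_discrete .of_discrete]
  simp [poissonMean]

theorem IsPoissonPointProcess.ae_finite (hE : IsPoissonPointProcess E μ P)
    {A : Set X} (hA : MeasurableSet A) (hμ : μ A < ∞) : ∀ᵐ ω ∂P, (E ω ∩ A).Finite := by
  have h := ae_lt_top (μ := P) (f := fun ω ↦ (pointCount E A ω : ℝ≥0∞))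
    (Measurable.of_discrete.comp (hE.measurable_pointCount A hA))
    (by rw [hE.lintegral_pointCount hA hμ]; exact poissonMean_ne_top _)
  filter_upwards [h] with ω hω
  simpa [pointCount] using hω

theorem IsPoissonPointProcess.measure_pointCount_eq_zero (hE : IsPoissonPointProcess E μ P)
    {A : Set X} (hA : MeasurableSet A) (hμ : μ A < ∞) :
    P {ω | pointCount E A ω = 0} = ENNReal.ofReal (Real.exp (-(μ A).toNNReal)) := by
  have h := hE.hasLaw_pointCount A hA hμ
  have h0 : P {ω | pointCount E A ω = 0} = P.map (pointCount E A) {0} := by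
    rw [Measure.map_apply (hE.measurable_pointCount A hA) .of_discrete]
    rfl
  have h1 : (Nat.cast : ℕ → ℕ∞) ⁻¹' {0} = {0} := by
    ext n
    simp
  rw [h0, h.map_eq, Measure.map_apply .of_discrete .of_discrete, h1, poissonMeasure_singleton]
  simp

end Poisson

end BrownianPercolation

namespace BrownianPercolation

/-! ### Why a covered integer has a nearby point or a far-travelling path -/

section FarEvent

variable {Ω : Type*} {E : Ω → Set ℝ} {W : ℕ × ℤ → ℝ≥0 → Ω → ℝ}

/-- The event that a path started at distance at least about `b` from `c` comes close to `c`. -/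
def farEvent (E : Ω → Set ℝ) (W : ℕ × ℤ → ℝ≥0 → Ω → ℝ) (t : ℝ≥0) (c : ℤ) (b : ℕ) : Set Ω :=
  {ω | ∃ j : ℤ, (b : ℤ) ≤ |j - c| ∧ ∃ i ∈ labelBlock j,
    IsUsed (E ω) i ∧ (fun s ↦ W i s ω) ∈ exceeds t (|(j : ℝ) - c| - 2)}

theorem pointCount_ne_zero_or_mem_farEvent {ω : Ω} {t : ℝ≥0}
    (hfin : ∀ j : ℤ, (E ω ∩ cube 0 j).Finite) (hcont : ∀ i, Continuous fun s ↦ W i s ω) {c : ℤ}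
    (hc : (c : ℝ) ∈ occupiedSet E W t ω) (b : ℕ) :
    pointCount E (Set.Ioc ((c : ℝ) - b) (c + b)) ω ≠ 0 ∨ ω ∈ farEvent E W t c b := by
  simp only [occupiedSet, Set.mem_iUnion, Set.mem_singleton_iff, path] at hc
  obtain ⟨x, hx, s, hs, hcs⟩ := hc
  by_cases hxc : x ∈ Set.Ioc ((c : ℝ) - b) (c + b)
  · left
    rw [pointCount, Set.encard_ne_zero]
    exact ⟨x, hx, hxc⟩
  right
  have hxj := mem_cube_cubeIndex 0 x
  set j := cubeIndex 0 x with hj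
  simp only [cube, pow_zero, div_one, Set.mem_Ioc] at hxj
  -- Rounding `x` to `j` loses at most `1`; the `2` in `farEvent` leaves room for strict inequality.
  have hdist : |x - c| ≥ |(j : ℝ) - c| - 1 := by
    rcases abs_cases (x - c) with h | h <;> rcases abs_cases ((j : ℝ) - c) with h' | h' <;> linarith
  refine ⟨j, ?_, label (E ω) x, label_mem_labelBlock _ _, isUsed_label hfin hx,
    mem_exceeds_of_continuous (hcont _) hs.2 ?_⟩
  · by_contra! h
    rw [abs_lt] at h
    obtain ⟨h1, h2⟩ := h
    have h1' : ((c : ℝ) - b) ≤ j := by exact_mod_cast (by lia : c - b ≤ j)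
    have h2' : (j : ℝ) + 1 ≤ c + b := by exact_mod_cast (by lia : j + 1 ≤ c + b)
    exact hxc ⟨h1'.trans_lt hxj.1, hxj.2.trans h2'⟩
  · rw [show W (label (E ω) x) s ω = -(x - c) by rw [hcs]; ring, abs_neg]
    linarith

end FarEvent

/-! ### Probability estimates and the uncovered integers -/

section Model

variable {Ω : Type*} [MeasurableSpace Ω] {P : Measure Ω} {lam : ℝ≥0} {E : Ω → Set ℝ}
  {W : ℕ × ℤ → ℝ≥0 → Ω → ℝ}

theorem measurableSet_cube (n : ℕ) (z : ℤ) : MeasurableSet (cube n z) := measurableSet_Ioc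

theorem smul_volume_cube_zero (lam : ℝ≥0) (j : ℤ) :
    (lam • (volume : Measure ℝ)) (cube 0 j) = lam := by
  rw [cube, Measure.smul_apply, Real.volume_Ioc, pow_zero, div_one, div_one,
    add_sub_cancel_left, ENNReal.ofReal_one, ENNReal.smul_def, smul_eq_mul, mul_one]

/-- The configurations of counts for which the label `i` is used. -/
def usedCounts (i : ℕ × ℤ) : Set ({A : Set ℝ // MeasurableSet A} → ℕ∞) :=
  {f | 1 ≤ i.1 ∧ f ⟨cube i.1 i.2, measurableSet_cube _ _⟩ = 1 ∧
    ∀ l, 1 ≤ l → l < i.1 → f ⟨cube l (cubeIndex l (rightEnd i)), measurableSet_cube _ _⟩ ≠ 1}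

theorem measurableSet_usedCounts (i : ℕ × ℤ) : MeasurableSet (usedCounts i) := by
  simp only [usedCounts, Set.ofPred_and, Set.ofPred_forall]
  exact (MeasurableSet.const _).inter <|
    ((measurableSet_singleton (1 : ℕ∞)).preimage (measurable_pi_apply _)).inter <|
    .iInter fun l ↦ .iInter fun _ ↦ .iInter fun _ ↦
    ((measurableSet_singleton (1 : ℕ∞)).compl.preimage (measurable_pi_apply _))

theorem IsModel.measurableSet_isUsed (hM : IsModel lam E W P) (i : ℕ × ℤ) :
    MeasurableSet {ω | IsUsed (E ω) i} :=
  (measurable_pi_lambda (fun (ω : Ω) (A : {A : Set ℝ // MeasurableSet A}) ↦ pointCount E A.1 ω)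
    fun A ↦ hM.isPoissonPointProcess.measurable_pointCount A.1 A.2) (measurableSet_usedCounts i)

theorem IsModel.measure_isUsed_inter_exceeds_le (hM : IsModel lam E W P) (i : ℕ × ℤ) (t : ℝ≥0)
    {a : ℝ} (ha : 0 ≤ a) (r : ℝ) :
    P {ω | IsUsed (E ω) i ∧ (fun s ↦ W i s ω) ∈ exceeds t r} ≤
      P {ω | IsUsed (E ω) i} * (4 * ENNReal.ofReal (Real.exp (a ^ 2 * t / 2 - a * r))) := by
  have h := hM.indepFun.measure_inter_preimage_eq_mul (usedCounts i) {g | g i ∈ exceeds t r}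
    (measurableSet_usedCounts i) ((measurableSet_exceeds t r).preimage (measurable_pi_apply i))
  refine Eq.trans_le h ?_
  gcongr
  · exact Set.Subset.rfl
  · exact measure_exceeds_le (hM.isBrownianReal i).toIsPreBrownianReal (hM.measurable i) t ha r

/-- By Tonelli the sum is the expected number of used labels, which is at most the expected number
of points. -/
theorem IsModel.tsum_measure_isUsed_le (hM : IsModel lam E W P) (j : ℤ) :
    ∑' i : labelBlock j, P {ω | IsUsed (E ω) i} ≤ poissonMean lam := by
  calc ∑' i : labelBlock j, P {ω | IsUsed (E ω) i}
      = ∑' i : labelBlock j, ∫⁻ ω, {ω | IsUsed (E ω) i}.indicator 1 ω ∂P := by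
        congr with i
        rw [lintegral_indicator_one (hM.measurableSet_isUsed i)]
    _ = ∫⁻ ω, ∑' i : labelBlock j, {ω | IsUsed (E ω) i}.indicator 1 ω ∂P :=
        (lintegral_tsum fun i : labelBlock j ↦
          (measurable_one.indicator (hM.measurableSet_isUsed i)).aemeasurable).symm
    _ ≤ ∫⁻ ω, (pointCount E (cube 0 j) ω : ℝ≥0∞) ∂P := by
        refine lintegral_mono fun ω ↦ ?_
        have h1 : ∑' i : labelBlock j, {ω | IsUsed (E ω) i}.indicator (1 : Ω → ℝ≥0∞) ω =
            ∑' _ : {i | i ∈ labelBlock j ∧ IsUsed (E ω) i}, (1 : ℝ≥0∞) := by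
          rw [tsum_subtype (labelBlock j)
            fun i ↦ {ω | IsUsed (E ω) i}.indicator (1 : Ω → ℝ≥0∞) ω,
            tsum_subtype {i | i ∈ labelBlock j ∧ IsUsed (E ω) i} fun _ ↦ (1 : ℝ≥0∞)]
          classical
          congr with i
          simp only [Set.indicator_apply, Set.mem_ofPred_eq, ite_and, Pi.one_apply]
        rw [h1, ENNReal.tsum_set_one]
        exact ENat.toENNReal_le.2 (encard_isUsed_le (E ω) j)
    _ = poissonMean lam := by
        rw [hM.isPoissonPointProcess.lintegral_pointCount (measurableSet_cube 0 j)
          (by rw [smul_volume_cube_zero]; exact ENNReal.coe_lt_top), smul_volume_cube_zero,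
          ENNReal.toNNReal_coe]

theorem tsum_exp_neg_abs_ne_top {α : ℝ} (hα : 0 < α) :
    ∑' j : ℤ, ENNReal.ofReal (Real.exp (-α * |(j : ℝ)|)) ≠ ∞ := by
  have hn : Summable fun n : ℕ ↦ Real.exp (-α * n) := by
    simpa [mul_comm] using Real.summable_exp_nat_mul_iff.2 (neg_lt_zero.2 hα)
  have h : Summable fun j : ℤ ↦ Real.exp (-α * |(j : ℝ)|) :=
    .of_nat_of_neg (by simpa using hn) (by simpa using hn)
  exact h.tsum_ofReal_ne_top

theorem IsModel.exists_measure_farEvent_le (hM : IsModel lam E W P) (t : ℝ≥0) {α : ℝ}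
    (hα : 0 < α) :
    ∃ C : ℝ≥0∞, C ≠ ∞ ∧ ∀ c b, P (farEvent E W t c b) ≤
      C * ENNReal.ofReal (Real.exp (-α * b)) := by
  -- The Chernoff parameter is `2 * α`: half of the decay yields `exp (-α * b)`, the other half
  -- makes the sum over `j` converge.
  set D : ℝ≥0∞ := poissonMean lam * 4 *
    ENNReal.ofReal (Real.exp ((2 * α) ^ 2 * t / 2 + 2 * α * 2)) with hD
  refine ⟨D * ∑' j : ℤ, ENNReal.ofReal (Real.exp (-α * |(j : ℝ)|)), ?_, fun c b ↦ ?_⟩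
  · exact ENNReal.mul_ne_top (ENNReal.mul_ne_top (ENNReal.mul_ne_top (poissonMean_ne_top _)
      (by simp)) ENNReal.ofReal_ne_top) (tsum_exp_neg_abs_ne_top hα)
  have hblock : ∀ j : ℤ, P {ω | (b : ℤ) ≤ |j - c| ∧ ∃ i ∈ labelBlock j,
      IsUsed (E ω) i ∧ (fun s ↦ W i s ω) ∈ exceeds t (|(j : ℝ) - c| - 2)} ≤
      D * ENNReal.ofReal (Real.exp (-α * b)) *
        ENNReal.ofReal (Real.exp (-α * |((j - c : ℤ) : ℝ)|)) := by
    intro j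
    by_cases hj : (b : ℤ) ≤ |j - c|
    swap
    · simp [hj]
    have hj' : (b : ℝ) ≤ |(j : ℝ) - c| := by exact_mod_cast hj
    set e := ENNReal.ofReal (Real.exp ((2 * α) ^ 2 * t / 2 - 2 * α * (|(j : ℝ) - c| - 2)))
    have he : e ≤ ENNReal.ofReal (Real.exp ((2 * α) ^ 2 * t / 2 + 2 * α * 2)) *
        ENNReal.ofReal (Real.exp (-α * b)) *
        ENNReal.ofReal (Real.exp (-α * |((j - c : ℤ) : ℝ)|)) := by
      rw [← ENNReal.ofReal_mul (by positivity), ← Real.exp_add,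
        ← ENNReal.ofReal_mul (by positivity), ← Real.exp_add]
      refine ENNReal.ofReal_le_ofReal (Real.exp_le_exp.2 ?_)
      push_cast
      nlinarith [mul_le_mul_of_nonneg_left hj' hα.le]
    calc _ ≤ P (⋃ i : labelBlock j, {ω | IsUsed (E ω) i ∧
          (fun s ↦ W i s ω) ∈ exceeds t (|(j : ℝ) - c| - 2)}) := by
          refine measure_mono ?_
          rintro ω ⟨-, i, hi, h⟩
          exact Set.mem_iUnion.2 ⟨⟨i, hi⟩, h⟩
      _ ≤ ∑' i : labelBlock j, P {ω | IsUsed (E ω) i} * (4 * e) :=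
          (measure_iUnion_le _).trans (ENNReal.tsum_le_tsum fun i ↦
            hM.measure_isUsed_inter_exceeds_le i t (by positivity) _)
      _ ≤ poissonMean lam * (4 * e) := by
          rw [ENNReal.tsum_mul_right]
          gcongr
          exact hM.tsum_measure_isUsed_le j
      _ ≤ _ := by
          refine (mul_le_mul_right (mul_le_mul_right he 4) _).trans_eq ?_
          rw [hD]
          ring
  calc P (farEvent E W t c b) ≤ ∑' j : ℤ, D * ENNReal.ofReal (Real.exp (-α * b)) *
        ENNReal.ofReal (Real.exp (-α * |((j - c : ℤ) : ℝ)|)) := by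
        have : farEvent E W t c b = ⋃ j : ℤ, {ω | (b : ℤ) ≤ |j - c| ∧ ∃ i ∈ labelBlock j,
            IsUsed (E ω) i ∧ (fun s ↦ W i s ω) ∈ exceeds t (|(j : ℝ) - c| - 2)} := by
          ext ω
          simp [farEvent]
        rw [this]
        exact (measure_iUnion_le _).trans (ENNReal.tsum_le_tsum hblock)
    _ = _ := by
        have hshift := (Equiv.subRight c).tsum_eq
          fun j : ℤ ↦ ENNReal.ofReal (Real.exp (-α * |(j : ℝ)|))
        simp only [Equiv.subRight_apply] at hshift
        rw [ENNReal.tsum_mul_left, hshift]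
        ring

theorem IsModel.ae_finite_and_continuous (hM : IsModel lam E W P) :
    ∀ᵐ ω ∂P, (∀ j : ℤ, (E ω ∩ cube 0 j).Finite) ∧ ∀ i, Continuous fun s ↦ W i s ω := by
  refine (ae_all_iff.2 fun j ↦ ?_).and (ae_all_iff.2 fun i ↦ (hM.isBrownianReal i).cont)
  exact hM.isPoissonPointProcess.ae_finite (measurableSet_cube 0 j)
    (by rw [smul_volume_cube_zero]; exact ENNReal.coe_lt_top)

theorem IsModel.measure_forall_pointCount_ne_zero [IsProbabilityMeasure P]
    (hM : IsModel lam E W P) (b K : ℕ) {c : ℕ → ℤ}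
    (hc : ∀ i j, i ≠ j → 2 * (b : ℤ) ≤ |c i - c j|) :
    P {ω | ∀ k < K, pointCount E (Set.Ioc ((c k : ℝ) - b) (c k + b)) ω ≠ 0} =
      (1 - ENNReal.ofReal (Real.exp (-(2 * lam * b)))) ^ K := by
  have hvol (k : ℕ) : (lam • (volume : Measure ℝ)) (Set.Ioc ((c k : ℝ) - b) (c k + b)) =
      (lam * (2 * b) : ℝ≥0) := by
    simp only [Measure.smul_apply, Real.volume_Ioc, ENNReal.smul_def, smul_eq_mul, ENNReal.coe_mul]
    congr 1
    rw [show (c k : ℝ) + b - (c k - b) = ((2 * b : ℝ≥0) : ℝ) by push_cast; ring,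
      ENNReal.ofReal_coe_nnreal, ENNReal.coe_mul]
  have hind := hM.isPoissonPointProcess.iIndepFun_pointCount K
    (fun k ↦ Set.Ioc ((c k : ℝ) - b) (c k + b)) (fun _ ↦ measurableSet_Ioc) fun i j hij ↦ by
      have h := hc i j fun h ↦ hij (Fin.ext h)
      rcases le_abs.1 h with h | h
      · have h' : (c j : ℝ) + b ≤ c i - b := by exact_mod_cast (by lia : c j + b ≤ c i - b)
        exact (Set.Ioc_disjoint_Ioc_of_le h').symm
      · have h' : (c i : ℝ) + b ≤ c j - b := by exact_mod_cast (by lia : c i + b ≤ c j - b)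
        exact Set.Ioc_disjoint_Ioc_of_le h'
  have hprod := hind.measure_inter_preimage_eq_mul Finset.univ (sets := fun _ ↦ {0}ᶜ)
    fun _ _ ↦ .of_discrete
  have hset : {ω | ∀ k < K, pointCount E (Set.Ioc ((c k : ℝ) - b) (c k + b)) ω ≠ 0} =
      ⋂ k ∈ (Finset.univ : Finset (Fin K)),
        pointCount E (Set.Ioc ((c k : ℝ) - b) (c k + b)) ⁻¹' {0}ᶜ := by
    ext ω
    simp [Fin.forall_iff]
  rw [hset, hprod, Finset.prod_eq_pow_card (b := 1 - ENNReal.ofReal (Real.exp (-(2 * lam * b)))),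
    Finset.card_univ, Fintype.card_fin]
  intro k _
  rw [Set.preimage_compl, prob_compl_eq_one_sub]
  · have h := hM.isPoissonPointProcess.measure_pointCount_eq_zero
      (A := Set.Ioc ((c k : ℝ) - b) (c k + b)) measurableSet_Ioc
      (by rw [hvol]; exact ENNReal.coe_lt_top)
    rw [hvol, ENNReal.toNNReal_coe] at h
    refine congrArg _ (h.trans ?_)
    push_cast
    ring_nf
  · exact hM.isPoissonPointProcess.measurable_pointCount _ measurableSet_Ioc .of_discrete

/-- With `1 - q ≤ exp (-q)`, the exponent is at least `exp (3lb) * exp (-2lb)`. -/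
theorem one_sub_ofReal_exp_pow_le {l : ℝ} (hl : 0 ≤ l) (b : ℕ) :
    (1 - ENNReal.ofReal (Real.exp (-(2 * l * b)))) ^ ⌈Real.exp (3 * l * b)⌉₊ ≤
      ENNReal.ofReal (Real.exp (-Real.exp (l * b))) := by
  set q := Real.exp (-(2 * l * b)) with hq
  have hq1 : q ≤ 1 := Real.exp_le_one_iff.2 (by rw [neg_nonpos]; positivity)
  rw [← ENNReal.ofReal_one, ← ENNReal.ofReal_sub _ (Real.exp_pos _).le,
    ← ENNReal.ofReal_pow (by linarith)]
  refine ENNReal.ofReal_le_ofReal ?_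
  calc (1 - q) ^ ⌈Real.exp (3 * l * b)⌉₊ ≤ Real.exp (-q) ^ ⌈Real.exp (3 * l * b)⌉₊ :=
        pow_le_pow_left₀ (by linarith) (Real.one_sub_le_exp_neg q) _
    _ = Real.exp (-(⌈Real.exp (3 * l * b)⌉₊ * q)) := by
        rw [← Real.exp_nat_mul, mul_neg]
    _ ≤ Real.exp (-(Real.exp (3 * l * b) * q)) := by
        gcongr
        exact Nat.le_ceil _
    _ = _ := by
        rw [hq, ← Real.exp_add]
        ring_nf

theorem ceil_exp_mul_ofReal_exp_le {l : ℝ} (hl : 0 ≤ l) (b : ℕ) :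
    (⌈Real.exp (3 * l * b)⌉₊ : ℝ≥0∞) * ENNReal.ofReal (Real.exp (-(4 * l) * b)) ≤
      ENNReal.ofReal (2 * Real.exp (-(l * b))) := by
  rw [← ENNReal.ofReal_natCast, ← ENNReal.ofReal_mul (by positivity)]
  refine ENNReal.ofReal_le_ofReal ?_
  have h1 : 1 ≤ Real.exp (3 * l * b) := Real.one_le_exp (by positivity)
  have h2 : (⌈Real.exp (3 * l * b)⌉₊ : ℝ) ≤ 2 * Real.exp (3 * l * b) :=
    (Nat.ceil_lt_add_one (by positivity)).le.trans (by linarith)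
  calc _ ≤ 2 * Real.exp (3 * l * b) * Real.exp (-(4 * l) * b) := by gcongr
    _ = _ := by
      rw [mul_assoc, ← Real.exp_add]
      ring_nf

/-- A set of integers that contains arbitrarily sparse infinite sequences is almost surely not
contained in the occupied set. -/
theorem IsModel.ae_exists_notMem_occupiedSet [IsProbabilityMeasure P] (hM : IsModel lam E W P)
    (hlam : 0 < lam) (t : ℝ≥0) {T : Set ℤ}
    (hT : ∀ b : ℕ, ∃ c : ℕ → ℤ, (∀ k, c k ∈ T) ∧ ∀ i j, i ≠ j → 2 * (b : ℤ) ≤ |c i - c j|) :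
    ∀ᵐ ω ∂P, ∃ c ∈ T, (c : ℝ) ∉ occupiedSet E W t ω := by
  have hl : (0 : ℝ) < lam := hlam
  -- The rate `4λ` must beat the `exp (3λb)` centres, whose number must in turn beat the void
  -- probability `exp (-2λb)`.
  obtain ⟨C, hC, hfar⟩ := hM.exists_measure_farEvent_le t (α := 4 * lam) (by positivity)
  have hbound : ∀ b : ℕ, P {ω | ∀ c ∈ T, (c : ℝ) ∈ occupiedSet E W t ω} ≤
      ENNReal.ofReal (Real.exp (-Real.exp (lam * b))) +
        C * ENNReal.ofReal (2 * Real.exp (-(lam * b))) := by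
    intro b
    obtain ⟨c, hcT, hc⟩ := hT b
    set K := ⌈Real.exp (3 * lam * b)⌉₊
    calc _ ≤ P ({ω | ∀ k < K, pointCount E (Set.Ioc ((c k : ℝ) - b) (c k + b)) ω ≠ 0} ∪
          ⋃ k ∈ Finset.range K, farEvent E W t (c k) b) := by
          refine measure_mono_ae ?_
          filter_upwards [hM.ae_finite_and_continuous] with ω hω hocc
          by_cases h : ∃ k < K, ω ∈ farEvent E W t (c k) b
          · obtain ⟨k, hk, h⟩ := h
            exact Or.inr (Set.mem_iUnion₂.2 ⟨k, Finset.mem_range.2 hk, h⟩)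
          · push Not at h
            exact Or.inl fun k hk ↦ (pointCount_ne_zero_or_mem_farEvent hω.1 hω.2
              (hocc (c k) (hcT k)) b).resolve_right (h k hk)
      _ ≤ _ := (measure_union_le _ _).trans (add_le_add_right (measure_biUnion_finset_le _ _) _)
      _ ≤ (1 - ENNReal.ofReal (Real.exp (-(2 * lam * b)))) ^ K +
          ∑ k ∈ Finset.range K, C * ENNReal.ofReal (Real.exp (-(4 * lam) * b)) :=
          add_le_add (hM.measure_forall_pointCount_ne_zero b K hc).le
            (Finset.sum_le_sum fun k _ ↦ hfar (c k) b)
      _ ≤ _ := by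
          refine add_le_add (one_sub_ofReal_exp_pow_le hl.le b) ?_
          rw [Finset.sum_const, Finset.card_range, nsmul_eq_mul, mul_left_comm]
          exact mul_le_mul_right (ceil_exp_mul_ofReal_exp_le hl.le b) C
  have hlin : Filter.Tendsto (fun b : ℕ ↦ (lam : ℝ) * b) Filter.atTop Filter.atTop :=
    tendsto_natCast_atTop_atTop.const_mul_atTop hl
  have hlim : Filter.Tendsto (fun b : ℕ ↦ ENNReal.ofReal (Real.exp (-Real.exp (lam * b))) +
      C * ENNReal.ofReal (2 * Real.exp (-(lam * b)))) Filter.atTop (nhds 0) := by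
    have h1 : Filter.Tendsto (fun b : ℕ ↦ ENNReal.ofReal (Real.exp (-Real.exp (lam * b))))
        Filter.atTop (nhds 0) := by
      simpa using ENNReal.tendsto_ofReal
        (Real.tendsto_exp_neg_atTop_nhds_zero.comp (Real.tendsto_exp_atTop.comp hlin))
    have h2 : Filter.Tendsto (fun b : ℕ ↦ ENNReal.ofReal (2 * Real.exp (-(lam * b))))
        Filter.atTop (nhds 0) := by
      simpa using ENNReal.tendsto_ofReal
        ((Real.tendsto_exp_neg_atTop_nhds_zero.comp hlin).const_mul 2)
    simpa using h1.add (ENNReal.Tendsto.const_mul h2 (Or.inr hC))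
  have hzero := le_antisymm (ge_of_tendsto' hlim hbound) (zero_le)
  rw [ae_iff]
  convert hzero using 3 with ω
  push Not
  rfl

theorem le_abs_sub_mul_of_ne (b : ℕ) {i j : ℕ} (h : i ≠ j) :
    2 * (b : ℤ) ≤ |2 * (b : ℤ) * i - 2 * b * j| := by
  rw [← mul_sub, abs_mul, abs_of_nonneg (by positivity : (0 : ℤ) ≤ 2 * b)]
  refine le_mul_of_one_le_right (by positivity) (Int.one_le_abs ?_)
  lia

/-- The range of the joining path is connected, so the intermediate value theorem applies;
maximality plays no role. -/
theorem IsComponent.ordConnected_subset {O C : Set ℝ} (hC : IsComponent O C) {x y z : ℝ}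
    (hx : x ∈ C) (hy : y ∈ C) (hz : z ∈ Set.Icc x y) : z ∈ O := by
  obtain ⟨γ, hγ⟩ := hC.2 x hx y hy
  have hpre := isPreconnected_range γ.continuous
  obtain ⟨s, rfl⟩ := hpre.Icc_subset γ.source_mem_range γ.target_mem_range hz
  exact hγ s

end Model

end BrownianPercolation

theorem theorem1p1 {Ω : Type*} [MeasurableSpace Ω] (P : Measure Ω) [IsProbabilityMeasure P]
    (lam : ℝ≥0) (hlam : 0 < lam) (E : Ω → Set ℝ) (W : ℕ × ℤ → ℝ≥0 → Ω → ℝ)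
    (hmodel : BrownianPercolation.IsModel lam E W P) (t : ℝ≥0) :
    ∀ᵐ ω ∂P, ¬ ∃ C : Set ℝ,
      BrownianPercolation.IsCluster (BrownianPercolation.occupiedSet E W t ω) C ∧
        ¬ Bornology.IsBounded C := by
  have hright : ∀ᵐ ω ∂P, ∀ m : ℤ, ∃ c ∈ Set.Ici m,
      (c : ℝ) ∉ BrownianPercolation.occupiedSet E W t ω := by
    refine ae_all_iff.2 fun m ↦ hmodel.ae_exists_notMem_occupiedSet hlam t fun b ↦
      ⟨fun k ↦ m + 2 * b * k, fun k ↦ Set.mem_Ici.2 (le_add_of_nonneg_right (by positivity)),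
        fun i j hij ↦ ?_⟩
    rw [add_sub_add_left_eq_sub]
    exact BrownianPercolation.le_abs_sub_mul_of_ne b hij
  have hleft : ∀ᵐ ω ∂P, ∀ m : ℤ, ∃ c ∈ Set.Iic m,
      (c : ℝ) ∉ BrownianPercolation.occupiedSet E W t ω := by
    refine ae_all_iff.2 fun m ↦ hmodel.ae_exists_notMem_occupiedSet hlam t fun b ↦
      ⟨fun k ↦ m - 2 * b * k, fun k ↦ Set.mem_Iic.2 (sub_le_self _ (by positivity)),
        fun i j hij ↦ ?_⟩
    rw [sub_sub_sub_cancel_left]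
    exact BrownianPercolation.le_abs_sub_mul_of_ne b hij.symm
  filter_upwards [hright, hleft] with ω hr hl
  rintro ⟨C, hC, hunb⟩
  have hcomp : BrownianPercolation.IsComponent (BrownianPercolation.occupiedSet E W t ω) C := hC.1
  have hne : C.Nonempty := by
    by_contra h
    exact hunb (Set.not_nonempty_iff_eq_empty.1 h ▸ Bornology.isBounded_empty)
  obtain ⟨x, hx⟩ := hne
  rw [isBounded_iff_bddBelow_bddAbove, not_and_or] at hunb
  rcases hunb with h | h
  · obtain ⟨c, hc, hcO⟩ := hl ⌊x⌋
    obtain ⟨y, hy, hyc⟩ := not_bddBelow_iff.1 h c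
    exact hcO (hcomp.ordConnected_subset hy hx ⟨hyc.le, Int.le_floor.1 hc⟩)
  · obtain ⟨c, hc, hcO⟩ := hr ⌈x⌉
    obtain ⟨y, hy, hyc⟩ := not_bddAbove_iff.1 h c
    exact hcO (hcomp.ordConnected_subset hx hy ⟨Int.ceil_le.1 hc, hyc.le⟩)
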